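/- Let $1\le\mu\le n$ be integers and let $P(z)=a_nz^n+\sum_{j=\mu}^{n}a_{n-j}z^{n-j}$ be a complex polynomial of degree $n$ all of whose zeros lie in $|z|\le k$, where $0<k\le 1$. Put $m=\min_{|z|=k}|P(z)|$ and let $D_\alpha P(z)=nP(z)+(\alpha-z)P'(z)$ be the polar derivative of $P$ with respect to $\alpha$. Then for all $\alpha,\beta\in\mathbb{C}$ with $|\alpha|\ge k^\mu$ and $|\beta|\le 1$, every real $p>0$ and all real $r,s>1$ with $\frac1r+\frac1s=1$, one has $|D_\alpha P(e^{i\theta})|-\frac{nm}{k^{n-\mu}}\ge 0$ for every real $\theta$, and $$n(|\alpha|-k^\mu)\Big\{\int_0^{2\pi}\Big|P(e^{i\theta})+\frac{m\beta}{k^{n-\mu}}\Big|^p d\theta\Big\}^{1/p}\le\Big\{\int_0^{2\pi}|1+k^\mu e^{i\theta}|^{pr}d\theta\Big\}^{1/(pr)}\Big\{\int_0^{2\pi}\Big(|D_\alpha P(e^{i\theta})|-\frac{nm}{k^{n-\mu}}\Big)^{ps}d\theta\Big\}^{1/(ps)}.$$ -/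

import Mathlib

open Polynomial

/-- The polar derivative `D_α P = n P + (α - z) P'` of a polynomial `P` of degree `n`
with respect to the complex number `α`. -/
noncomputable def polarDerivative (α : ℂ) (P : ℂ[X]) : ℂ[X] :=
  C (P.natDegree : ℂ) * P + (C α - X) * derivative P

open Metric Filter Topology

/-! Let Q(z) = z^n conj(P(1/conj z)). It has no zeros in |z| < 1/k, its coefficients of order 1,
..., μ-1 vanish, and on |z| = 1 one has |nQ - zQ'| = |P'| and |zQ'| = |nP - zP'|.

For a polynomial of degree at most n without zeros in the unit disc, Re(zQ'/Q) ≤ n/2, that is |zQ'|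
≤ |nQ - zQ'|. Since zQ' vanishes to order at least μ at 0, the maximum principle improves this by a
factor |z|^μ. Perturbing Q by a constant smaller than its minimum and rescaling by k give |nP - zP'|
+ nm/k^(n-μ) ≤ k^μ |P'| on the unit circle (`norm_mul_derivative_conjReverse_add_le`).

This inequality is used twice. With D_α P = αP' + (nP - zP') it gives (|α| - k^μ)|P'| ≤ |D_α P| -
nm/k^(n-μ). With δ = mβ/k^(n-μ) it shows that w = (zQ' + n conj(δ) z^n) / (k^μ (nQ - zQ')) is a
Schwarz function: w(0) = 0 and |w| ≤ 1. On the circle n|P + δ| = |P'| |1 + k^μ w|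
(`exists_subordinate_factor`).

Multiplying the two and applying Hölder leaves the mean of |1 + k^μ w|^(pr), which Littlewood
subordination (`integral_norm_one_add_mul_rpow_le`) bounds by that of |1 + k^μ z|^(pr). -/

/-! ### Subordination in L² on the unit circle -/

theorem ContinuousOn.circleIntegrable_unit {E : Type*} [NormedAddCommGroup E] {F : ℂ → E}
    (hF : ContinuousOn F (closedBall 0 1)) : CircleIntegrable F 0 1 :=
  (hF.mono sphere_subset_closedBall).circleIntegrable zero_le_one

theorem DiffContOnCl.continuousOn_closedBall_one {F : ℂ → ℂ}
    (hF : DiffContOnCl ℂ F (ball 0 1)) : ContinuousOn F (closedBall 0 1) := by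
  have := hF.continuousOn
  rwa [closure_ball _ one_ne_zero] at this

/-- Orthogonality of a constant and a holomorphic function vanishing at the origin. -/
theorem circleAverage_norm_const_add_sq (c : ℂ) {F : ℂ → ℂ} (hF : DiffContOnCl ℂ F (ball 0 1))
    (hF0 : F 0 = 0) :
    Real.circleAverage (fun z => ‖c + F z‖ ^ 2) 0 1
      = ‖c‖ ^ 2 + Real.circleAverage (fun z => ‖F z‖ ^ 2) 0 1 := by
  have hc := hF.continuousOn_closedBall_one
  have hG : DiffContOnCl ℂ (fun z => (starRingEnd ℂ c) * F z) (ball 0 1) := by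
    exact hF.const_smul (starRingEnd ℂ c)
  have h1 : Real.circleAverage (fun z => (starRingEnd ℂ c) * F z) 0 1 = 0 := by
    rw [DiffContOnCl.circleAverage (by simpa using hG), hF0, mul_zero]
  have hGc := hG.continuousOn_closedBall_one
  have h2 : Real.circleAverage (fun z => ((starRingEnd ℂ c) * F z).re) 0 1 = 0 := by
    have := Complex.reCLM.circleAverage_comp_comm
      (ContinuousOn.circleIntegrable_unit hGc)
    rw [h1] at this
    simpa [Function.comp_def] using this
  have e : (fun z => ‖c + F z‖ ^ 2)
      = fun z => (‖c‖ ^ 2 + ‖F z‖ ^ 2) + (2 : ℝ) • ((starRingEnd ℂ c) * F z).re := by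
    funext z
    rw [← Complex.normSq_eq_norm_sq, ← Complex.normSq_eq_norm_sq, ← Complex.normSq_eq_norm_sq,
      Complex.normSq_add]
    simp only [Complex.mul_re, Complex.conj_re, Complex.conj_im, smul_eq_mul]
    ring
  have i1 : CircleIntegrable (fun z => ‖F z‖ ^ 2) 0 1 :=
    ContinuousOn.circleIntegrable_unit (hc.norm.pow 2)
  have i0 : CircleIntegrable (fun _ : ℂ => ‖c‖ ^ 2) 0 1 :=
    ContinuousOn.circleIntegrable_unit continuousOn_const
  have i3 : CircleIntegrable (fun z => (2 : ℝ) • ((starRingEnd ℂ c) * F z).re) 0 1 :=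
    ContinuousOn.circleIntegrable_unit
      ((Complex.continuous_re.comp_continuousOn hGc).const_smul (2 : ℝ))
  have i4 : CircleIntegrable (fun z => ‖c‖ ^ 2 + ‖F z‖ ^ 2) 0 1 := i0.add i1
  rw [e, Real.circleAverage_fun_add i4 i3, Real.circleAverage_fun_add i0 i1,
    Real.circleAverage_const, Real.circleAverage_fun_smul, h2]
  simp

section Series

variable {a : ℕ → ℂ} {w : ℂ → ℂ}

theorem norm_coeff_mul_pow_le (hw1 : ∀ z ∈ closedBall (0 : ℂ) 1, ‖w z‖ ≤ 1) (j N : ℕ) (z : ℂ)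
    (hz : z ∈ closedBall (0 : ℂ) 1) : ‖a (j + N) * w z ^ j‖ ≤ ‖a (j + N)‖ := by
  rw [norm_mul, norm_pow]
  exact mul_le_of_le_one_right (norm_nonneg _) (pow_le_one₀ (norm_nonneg _) (hw1 z hz))

theorem diffContOnCl_tsum_comp (ha : Summable fun j => ‖a j‖) (hw : DiffContOnCl ℂ w (ball 0 1))
    (hw1 : ∀ z ∈ closedBall (0 : ℂ) 1, ‖w z‖ ≤ 1) (N : ℕ) :
    DiffContOnCl ℂ (fun z => ∑' j, a (j + N) * w z ^ j) (ball 0 1) := by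
  have hs : Summable fun j => ‖a (j + N)‖ := (summable_nat_add_iff N).2 ha
  constructor
  · refine DifferentiableOn.congr (Complex.differentiableOn_tsum_of_summable_norm hs (fun j => ?_)
      isOpen_ball fun j z hz => norm_coeff_mul_pow_le hw1 j N z (ball_subset_closedBall hz))
      fun _ _ => rfl
    exact (hw.differentiableOn.pow j).const_mul _
  · rw [closure_ball _ one_ne_zero]
    exact continuousOn_tsum (fun j => (hw.continuousOn_closedBall_one.pow j).const_mul _) hs
      fun j z hz => norm_coeff_mul_pow_le hw1 j N z hz

theorem tsum_comp_succ (ha : Summable fun j => ‖a j‖)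
    (hw1 : ∀ z ∈ closedBall (0 : ℂ) 1, ‖w z‖ ≤ 1) (N : ℕ) {z : ℂ} (hz : z ∈ closedBall (0 : ℂ) 1) :
    ∑' j, a (j + N) * w z ^ j = a N + w z * ∑' j, a (j + (N + 1)) * w z ^ j := by
  have hs : Summable fun j => a (j + N) * w z ^ j :=
    Summable.of_norm_bounded ((summable_nat_add_iff N).2 ha)
      fun j => norm_coeff_mul_pow_le hw1 j N z hz
  rw [hs.tsum_eq_zero_add, ← tsum_mul_left]
  simp only [zero_add, pow_zero, mul_one, add_right_inj]
  refine tsum_congr fun j => ?_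
  rw [show j + 1 + N = j + (N + 1) by ring]
  ring

theorem circleAverage_tsum_comp_succ (ha : Summable fun j => ‖a j‖)
    (hw : DiffContOnCl ℂ w (ball 0 1)) (hw0 : w 0 = 0)
    (hw1 : ∀ z ∈ closedBall (0 : ℂ) 1, ‖w z‖ ≤ 1) (N : ℕ) :
    Real.circleAverage (fun z => ‖∑' j, a (j + N) * w z ^ j‖ ^ 2) 0 1
      = ‖a N‖ ^ 2 + Real.circleAverage
          (fun z => ‖w z * ∑' j, a (j + (N + 1)) * w z ^ j‖ ^ 2) 0 1 := by
  rw [← circleAverage_norm_const_add_sq (a N)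
    (by simpa using hw.smul (diffContOnCl_tsum_comp ha hw hw1 (N + 1))) (by simp [hw0])]
  refine Real.circleAverage_congr_sphere fun z hz => ?_
  rw [tsum_comp_succ ha hw1 N (sphere_subset_closedBall (by simpa using hz))]

/-- The tails satisfy T_N = a_N + w T_(N+1) with w(0) = 0, so orthogonality splits off |a_N|²
exactly; |w| ≤ 1 then allows the factor w to be dropped before the next step. -/
theorem circleAverage_tsum_comp_le_sum_add (ha : Summable fun j => ‖a j‖)
    (hw : DiffContOnCl ℂ w (ball 0 1)) (hw0 : w 0 = 0)
    (hw1 : ∀ z ∈ closedBall (0 : ℂ) 1, ‖w z‖ ≤ 1) (N : ℕ) :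
    Real.circleAverage (fun z => ‖∑' j, a (j + 0) * w z ^ j‖ ^ 2) 0 1
      ≤ ∑ j ∈ Finset.range N, ‖a j‖ ^ 2
        + Real.circleAverage (fun z => ‖∑' j, a (j + N) * w z ^ j‖ ^ 2) 0 1 := by
  induction N with
  | zero => simp
  | succ N ih =>
    rw [circleAverage_tsum_comp_succ ha hw hw0 hw1 N] at ih
    rw [Finset.sum_range_succ, add_assoc]
    refine ih.trans ?_
    refine add_le_add_right (add_le_add_right ?_ _) _
    have hT := (diffContOnCl_tsum_comp ha hw hw1 (N + 1)).continuousOn_closedBall_one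
    refine Real.circleAverage_mono
      (ContinuousOn.circleIntegrable_unit ((hw.continuousOn_closedBall_one.mul hT).norm.pow 2))
      (ContinuousOn.circleIntegrable_unit (hT.norm.pow 2)) fun z hz => ?_
    rw [norm_mul]
    have := hw1 z (sphere_subset_closedBall (by simpa using hz))
    gcongr
    exact mul_le_of_le_one_left (norm_nonneg _) this

/-- For w = id nothing is lost in the recursion, since |z| = 1 on the circle. Comparing with the
inequality for general w gives subordination up to a tail. -/
theorem sum_add_circleAverage_tsum_eq (ha : Summable fun j => ‖a j‖) (N : ℕ) :
    ∑ j ∈ Finset.range N, ‖a j‖ ^ 2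
        + Real.circleAverage (fun z => ‖∑' j, a (j + N) * z ^ j‖ ^ 2) 0 1
      = Real.circleAverage (fun z => ‖∑' j, a (j + 0) * z ^ j‖ ^ 2) 0 1 := by
  induction N with
  | zero => simp
  | succ N ih =>
    have h := circleAverage_tsum_comp_succ (w := id) ha differentiable_id.diffContOnCl rfl
      (by simp) N
    simp only [id] at h
    rw [← ih, h, Finset.sum_range_succ, add_assoc]
    congr 2
    refine Real.circleAverage_congr_sphere fun z hz => ?_
    have : ‖z‖ = 1 := by simpa using hz
    simp [this]

/-- Rogosinski's form of Littlewood's subordination principle in `L²`. -/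
theorem circleAverage_norm_sq_tsum_comp_le (ha : Summable fun j => ‖a j‖)
    (hw : DiffContOnCl ℂ w (ball 0 1)) (hw0 : w 0 = 0)
    (hw1 : ∀ z ∈ closedBall (0 : ℂ) 1, ‖w z‖ ≤ 1) :
    Real.circleAverage (fun z => ‖∑' j, a j * w z ^ j‖ ^ 2) 0 1
      ≤ Real.circleAverage (fun z => ‖∑' j, a j * z ^ j‖ ^ 2) 0 1 := by
  -- The error is the sup bound for the N-th tail; it tends to 0 by absolute summability.
  have key : ∀ N, Real.circleAverage (fun z => ‖∑' j, a j * w z ^ j‖ ^ 2) 0 1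
      ≤ Real.circleAverage (fun z => ‖∑' j, a j * z ^ j‖ ^ 2) 0 1
        + (∑' j, ‖a (j + N)‖) ^ 2 := by
    intro N
    have h1 := circleAverage_tsum_comp_le_sum_add ha hw hw0 hw1 N
    have h2 := sum_add_circleAverage_tsum_eq ha N
    have h3 : 0 ≤ Real.circleAverage (fun z => ‖∑' j, a (j + N) * z ^ j‖ ^ 2) 0 1 :=
      Real.circleAverage_nonneg_of_nonneg fun z _ => by positivity
    have hs : Summable fun j => ‖a (j + N)‖ := (summable_nat_add_iff N).2 ha
    have h4 : Real.circleAverage (fun z => ‖∑' j, a (j + N) * w z ^ j‖ ^ 2) 0 1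
        ≤ (∑' j, ‖a (j + N)‖) ^ 2 := by
      refine Real.circleAverage_mono_on_of_le_circle (ContinuousOn.circleIntegrable_unit
        ((diffContOnCl_tsum_comp ha hw hw1 N).continuousOn_closedBall_one.norm.pow 2))
        fun z hz => ?_
      gcongr
      exact tsum_of_norm_bounded hs.hasSum fun j =>
        norm_coeff_mul_pow_le hw1 j N z (sphere_subset_closedBall (by simpa using hz))
    simp only [add_zero] at h1 h2
    linarith
  have hlim := ((tendsto_sum_nat_add fun j => ‖a j‖).pow 2).const_add
    (Real.circleAverage (fun z => ‖∑' j, a j * z ^ j‖ ^ 2) 0 1)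
  have := ge_of_tendsto' hlim key
  simpa using this

end Series

/-- Littlewood's subordination principle in `L²` for functions holomorphic on a larger disc. -/
theorem circleAverage_norm_sq_comp_le {f w : ℂ → ℂ} {R : ℝ} (hR : 1 < R)
    (hf : DifferentiableOn ℂ f (closedBall 0 R))
    (hw : DiffContOnCl ℂ w (ball 0 1)) (hw0 : w 0 = 0)
    (hw1 : ∀ z ∈ closedBall (0 : ℂ) 1, ‖w z‖ ≤ 1) :
    Real.circleAverage (fun z => ‖f (w z)‖ ^ 2) 0 1
      ≤ Real.circleAverage (fun z => ‖f z‖ ^ 2) 0 1 := by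
  lift R to NNReal using by linarith
  have hR' : (1 : NNReal) < R := by exact_mod_cast hR
  have hp := hf.hasFPowerSeriesOnBall (zero_lt_one.trans hR')
  set p := cauchyPowerSeries f 0 R
  have hrad : ((1 : NNReal) : ENNReal) < p.radius :=
    lt_of_lt_of_le (by exact_mod_cast hR') hp.r_le
  have hs : Summable fun j => ‖p.coeff j‖ := by
    simpa [FormalMultilinearSeries.norm_apply_eq_norm_coef] using p.summable_norm_mul_pow hrad
  have hsum : ∀ z ∈ closedBall (0 : ℂ) 1, ∑' j, p.coeff j * z ^ j = f z := by
    intro z hz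
    have hz' : z ∈ Metric.eball (0 : ℂ) (R : ENNReal) := by
      rw [Metric.eball_coe]
      exact closedBall_subset_ball hR hz
    have := (hp.hasSum hz').tsum_eq
    simpa [FormalMultilinearSeries.apply_eq_pow_smul_coeff, mul_comm] using this
  have := circleAverage_norm_sq_tsum_comp_le hs hw hw0 hw1
  refine le_of_eq_of_le ?_ (this.trans_eq ?_)
  · refine Real.circleAverage_congr_sphere fun z hz => ?_
    rw [hsum _ (by simpa using hw1 z (sphere_subset_closedBall (by simpa using hz)))]
  · refine Real.circleAverage_congr_sphere fun z hz => ?_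
    rw [hsum _ (sphere_subset_closedBall (by simpa using hz))]

/-! ### Subordination for powers of |1 + tz| -/

/-- The L² principle applies to (1 + tζ)^(q/2), whose squared modulus is |1 + tζ|^q. For t < 1 this
function is holomorphic beyond the closed unit disc. -/
theorem integral_norm_one_add_mul_rpow_le_of_lt_one {w : ℂ → ℂ}
    (hw : DiffContOnCl ℂ w (ball 0 1)) (hw0 : w 0 = 0)
    (hw1 : ∀ z ∈ closedBall (0 : ℂ) 1, ‖w z‖ ≤ 1) {t : ℝ} (ht0 : 0 < t) (ht1 : t < 1) (q : ℝ) :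
    ∫ θ in (0 : ℝ)..(2 * Real.pi), ‖1 + (t : ℂ) * w (Complex.exp (θ * Complex.I))‖ ^ q
      ≤ ∫ θ in (0 : ℝ)..(2 * Real.pi), ‖1 + (t : ℂ) * Complex.exp (θ * Complex.I)‖ ^ q := by
  -- With 1 < R < 1/t, the point 1 + tζ stays in the right half plane for |ζ| ≤ R, so the principal
  -- branch is holomorphic there.
  obtain ⟨R, hR, hRt⟩ := exists_between ((one_lt_inv₀ ht0).2 ht1)
  have hf : DifferentiableOn ℂ (fun ζ : ℂ => (1 + (t : ℂ) * ζ) ^ ((q / 2 : ℝ) : ℂ))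
      (closedBall 0 R) := by
    intro ζ hζ
    refine DifferentiableAt.differentiableWithinAt ?_
    refine DifferentiableAt.cpow_const (by fun_prop) ?_
    left
    have h1 : ‖(t : ℂ) * ζ‖ < 1 := by
      rw [norm_mul, Complex.norm_real, Real.norm_of_nonneg ht0.le]
      have : ‖ζ‖ ≤ R := by simpa using hζ
      calc t * ‖ζ‖ ≤ t * R := by gcongr
        _ < t * t⁻¹ := by gcongr
        _ = 1 := mul_inv_cancel₀ ht0.ne'
    have h2 := (abs_le.1 (Complex.abs_re_le_norm ((t : ℂ) * ζ))).1
    rw [Complex.add_re, Complex.one_re]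
    linarith
  have h := circleAverage_norm_sq_comp_le hR hf hw hw0 hw1
  have e : ∀ ζ : ℂ, ‖(1 + (t : ℂ) * ζ) ^ ((q / 2 : ℝ) : ℂ)‖ ^ 2 = ‖1 + (t : ℂ) * ζ‖ ^ q := by
    intro ζ
    rw [Complex.norm_cpow_real, ← Real.rpow_natCast, ← Real.rpow_mul (norm_nonneg _)]
    norm_num
  simp only [e, Real.circleAverage, circleMap, smul_eq_mul, zero_add, Complex.ofReal_one,
    one_mul] at h
  exact le_of_mul_le_mul_left h (by positivity)

/-- Littlewood's subordination principle for `1 + t z`, in `L^q`. -/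
theorem integral_norm_one_add_mul_rpow_le {w : ℂ → ℂ}
    (hw : DiffContOnCl ℂ w (ball 0 1)) (hw0 : w 0 = 0)
    (hw1 : ∀ z ∈ closedBall (0 : ℂ) 1, ‖w z‖ ≤ 1) {t : ℝ} (ht0 : 0 < t) (ht1 : t ≤ 1)
    {q : ℝ} (hq : 0 < q) :
    ∫ θ in (0 : ℝ)..(2 * Real.pi), ‖1 + (t : ℂ) * w (Complex.exp (θ * Complex.I))‖ ^ q
      ≤ ∫ θ in (0 : ℝ)..(2 * Real.pi), ‖1 + (t : ℂ) * Complex.exp (θ * Complex.I)‖ ^ q := by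
  rcases ht1.lt_or_eq with h | rfl
  · exact integral_norm_one_add_mul_rpow_le_of_lt_one hw hw0 hw1 ht0 h q
  -- At t = 1 the base may vanish on the circle, so t tends to 1 from below. Continuity of the
  -- integrals in t relies on q > 0.
  have hcont : ∀ v : ℝ → ℂ, Continuous v →
      Continuous fun t : ℝ => ∫ θ in (0 : ℝ)..(2 * Real.pi), ‖1 + (t : ℂ) * v θ‖ ^ q := by
    intro v hv
    refine intervalIntegral.continuous_parametric_intervalIntegral_of_continuous' ?_ _ _
    refine Continuous.rpow_const (by fun_prop) fun _ => Or.inr hq.le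
  have hwc : Continuous fun θ : ℝ => w (Complex.exp (θ * Complex.I)) :=
    hw.continuousOn_closedBall_one.comp_continuous (by fun_prop) fun θ => by
      simp [Complex.norm_exp_ofReal_mul_I]
  have h1 := ((hcont _ hwc).tendsto 1).mono_left (nhdsWithin_le_nhds (s := Set.Iio 1))
  have h2 := ((hcont (fun θ : ℝ => Complex.exp (θ * Complex.I)) (by fun_prop)).tendsto 1).mono_left
    (nhdsWithin_le_nhds (s := Set.Iio 1))
  refine le_of_tendsto_of_tendsto h1 h2 ?_
  filter_upwards [Ioo_mem_nhdsLT (zero_lt_one' ℝ)] with t ht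
  exact integral_norm_one_add_mul_rpow_le_of_lt_one hw hw0 hw1 ht.1 ht.2 q

/-! ### Quotients of polynomials and the maximum principle -/

theorem Polynomial.eventually_eval_ne_zero {d : ℂ[X]} (hd : d ≠ 0) (z : ℂ) :
    ∀ᶠ x in 𝓝[≠] z, d.eval x ≠ 0 := by
  have hfin : {x | d.IsRoot x}.Finite := Polynomial.finite_setOfPred_isRoot hd
  have h : ({x | d.IsRoot x} \ {z})ᶜ ∈ 𝓝 z :=
    (hfin.subset Set.sdiff_subset).isClosed.isOpen_compl.mem_nhds (by simp)
  filter_upwards [mem_nhdsWithin_of_mem_nhds h, self_mem_nhdsWithin] with x hx hxz h0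
  exact hx ⟨h0, hxz⟩

/-- A polynomial inequality on the unit circle may be divided by a common factor. -/
theorem Polynomial.norm_eval_le_of_mul_left {d A B : ℂ[X]} (hd : d ≠ 0)
    (h : ∀ z : ℂ, ‖z‖ = 1 → ‖(d * A).eval z‖ ≤ ‖(d * B).eval z‖) {z : ℂ} (hz : ‖z‖ = 1) :
    ‖A.eval z‖ ≤ ‖B.eval z‖ := by
  have hz0 : z ≠ 0 := by
    rintro rfl
    simp at hz
  -- Zeros of d on the circle are handled by approaching z along the circle; the nonzero velocity of
  -- the path keeps it off z itself, hence eventually off all zeros of d.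
  have hder : HasDerivAt (fun θ : ℝ => z * Complex.exp (θ * Complex.I)) (z * Complex.I) 0 := by
    have h1 : HasDerivAt (fun θ : ℂ => z * Complex.exp (θ * Complex.I)) (z * Complex.I)
        ((0 : ℝ) : ℂ) := by
      have := (((hasDerivAt_id ((0 : ℝ) : ℂ)).mul_const Complex.I).cexp).const_mul z
      simpa using this
    exact h1.comp_ofReal
  have ht : Tendsto (fun θ : ℝ => z * Complex.exp (θ * Complex.I)) (𝓝[≠] 0) (𝓝[≠] z) := by
    have := hder.tendsto_nhdsNE (mul_ne_zero hz0 Complex.I_ne_zero)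
    simpa using this
  have ht' := ht.mono_right nhdsWithin_le_nhds
  refine le_of_tendsto_of_tendsto ((A.continuous.norm.tendsto z).comp ht')
    ((B.continuous.norm.tendsto z).comp ht') ?_
  filter_upwards [ht.eventually (eventually_eval_ne_zero hd z)] with θ hθ
  have := h (z * Complex.exp (θ * Complex.I)) (by simp [hz, Complex.norm_exp_ofReal_mul_I])
  rw [eval_mul, eval_mul, norm_mul, norm_mul] at this
  exact le_of_mul_le_mul_left this (norm_pos_iff.2 hθ)

/-- The quotient of two polynomials `A`, `B` with `‖A‖ ≤ ‖B‖` on the unit circle and `B` zero-free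
in the open disc extends continuously to the closed disc. -/
theorem Polynomial.exists_diffContOnCl_quotient {A B : ℂ[X]}
    (hB : ∀ z : ℂ, ‖z‖ < 1 → B.eval z ≠ 0)
    (hAB : ∀ z : ℂ, ‖z‖ = 1 → ‖A.eval z‖ ≤ ‖B.eval z‖) :
    ∃ w : ℂ → ℂ, DiffContOnCl ℂ w (ball 0 1) ∧ (∀ z ∈ closedBall (0 : ℂ) 1, ‖w z‖ ≤ 1) ∧
      ∀ z ∈ closedBall (0 : ℂ) 1, A.eval z = w z * B.eval z := by
  have hB0 : B ≠ 0 := by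
    rintro rfl
    exact hB 0 (by simp) (by simp)
  have hd0 : EuclideanDomain.gcd A B ≠ 0 := fun h => hB0 (EuclideanDomain.gcd_eq_zero_iff.1 h).2
  obtain ⟨A', hA'⟩ := EuclideanDomain.gcd_dvd_left A B
  obtain ⟨B', hB'⟩ := EuclideanDomain.gcd_dvd_right A B
  have hbez := EuclideanDomain.gcd_eq_gcd_ab A B
  set d := EuclideanDomain.gcd A B
  set u := EuclideanDomain.gcdA A B
  set v := EuclideanDomain.gcdB A B
  have hco : A' * u + B' * v = 1 := by
    refine mul_left_cancel₀ hd0 ?_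
    calc d * (A' * u + B' * v) = (d * A') * u + (d * B') * v := by ring
      _ = d * 1 := by rw [← hA', ← hB', ← hbez, mul_one]
  have hle : ∀ z : ℂ, ‖z‖ = 1 → ‖A'.eval z‖ ≤ ‖B'.eval z‖ := fun z hz =>
    norm_eval_le_of_mul_left hd0 (by rw [← hA', ← hB']; exact hAB) hz
  -- On the boundary a zero of B' would be a zero of A' by `hle`, contradicting the Bézout relation.
  have hB1 : ∀ z ∈ closedBall (0 : ℂ) 1, B'.eval z ≠ 0 := by
    intro z hz h0
    have hz' : ‖z‖ ≤ 1 := by simpa using hz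
    rcases hz'.lt_or_eq with h | h
    · apply hB z h
      rw [hB', eval_mul, h0, mul_zero]
    · have h1 := hle z h
      rw [h0, norm_zero, norm_le_zero_iff] at h1
      have := congrArg (eval z) hco
      simp [h0, h1] at this
  have hcl : closure (ball (0 : ℂ) 1) = closedBall 0 1 := closure_ball _ one_ne_zero
  have hdiff : DiffContOnCl ℂ (fun z => A'.eval z / B'.eval z) (ball 0 1) := by
    refine DifferentiableOn.diffContOnCl ?_
    rw [hcl]
    exact A'.differentiable.differentiableOn.div B'.differentiable.differentiableOn hB1
  refine ⟨_, hdiff, fun z hz => ?_, fun z hz => ?_⟩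
  · refine Complex.norm_le_of_forall_mem_frontier_norm_le isBounded_ball hdiff (fun x hx => ?_)
      (hcl ▸ hz)
    rw [frontier_ball _ one_ne_zero] at hx
    rw [norm_div]
    exact div_le_one_of_le₀ (hle x (by simpa using hx)) (norm_nonneg _)
  · have e1 : A.eval z = d.eval z * A'.eval z := by rw [← eval_mul, ← hA']
    have e2 : B.eval z = d.eval z * B'.eval z := by rw [← eval_mul, ← hB']
    rw [e1, e2]
    field_simp [hB1 z hz]

theorem Polynomial.norm_eval_le_of_circle {A B : ℂ[X]}
    (hB : ∀ z : ℂ, ‖z‖ < 1 → B.eval z ≠ 0)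
    (hAB : ∀ z : ℂ, ‖z‖ = 1 → ‖A.eval z‖ ≤ ‖B.eval z‖) {z : ℂ} (hz : ‖z‖ ≤ 1) :
    ‖A.eval z‖ ≤ ‖B.eval z‖ := by
  obtain ⟨w, -, h1, h2⟩ := exists_diffContOnCl_quotient hB hAB
  have hz' : z ∈ closedBall (0 : ℂ) 1 := by simpa using hz
  rw [h2 z hz', norm_mul]
  exact mul_le_of_le_one_left (norm_nonneg _) (h1 z hz')

/-! ### Logarithmic derivatives of polynomials without zeros in a disc -/

/-- The line Re a = c/2 is the perpendicular bisector of the segment from 0 to c. -/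
theorem Complex.norm_le_norm_ofReal_sub_iff {c : ℝ} (hc : 0 < c) (a : ℂ) :
    ‖a‖ ≤ ‖(c : ℂ) - a‖ ↔ a.re ≤ c / 2 := by
  rw [← sq_le_sq₀ (norm_nonneg _) (norm_nonneg _), ← Complex.normSq_eq_norm_sq,
    ← Complex.normSq_eq_norm_sq, Complex.normSq_apply, Complex.normSq_apply]
  simp only [Complex.sub_re, Complex.sub_im, Complex.ofReal_re, Complex.ofReal_im]
  constructor
  · intro h
    by_contra! h'
    nlinarith [mul_lt_mul_of_pos_left h' hc]
  · intro h
    nlinarith [mul_le_mul_of_nonneg_left h hc.le]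

/-- The logarithmic derivative is a sum of terms z/(z - r) over the roots r. Since |z| < 1 ≤ |r|,
each term is no farther from 0 than from 1, so its real part is at most 1/2. -/
theorem Polynomial.re_mul_derivative_div_le {Q : ℂ[X]} (hQ : ∀ z : ℂ, ‖z‖ < 1 → Q.eval z ≠ 0)
    {z : ℂ} (hz : ‖z‖ < 1) :
    (z * (derivative Q).eval z / Q.eval z).re ≤ Q.natDegree / 2 := by
  rw [mul_div_assoc, (IsAlgClosed.splits Q).eval_derivative_div_eval_of_ne_zero (hQ z hz),
    ← Multiset.sum_map_mul_left]
  have hre := map_multiset_sum Complex.reAddGroupHom (Q.roots.map fun r => z * (1 / (z - r)))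
  rw [Complex.coe_reAddGroupHom] at hre
  rw [hre, Multiset.map_map]
  have hterm : ∀ x ∈ Q.roots.map (Complex.re ∘ fun r => z * (1 / (z - r))), x ≤ (1 / 2 : ℝ) := by
    intro x hx
    obtain ⟨r, hr, rfl⟩ := Multiset.mem_map.1 hx
    have hr0 : Q.eval r = 0 := (mem_roots'.1 hr).2
    have hr1 : 1 ≤ ‖r‖ := by
      by_contra! h
      exact hQ r h hr0
    have hzr : z - r ≠ 0 := by
      intro h
      rw [sub_eq_zero] at h
      rw [h] at hz
      linarith
    refine (Complex.norm_le_norm_ofReal_sub_iff one_pos _).1 ?_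
    have e : ((1 : ℝ) : ℂ) - z * (1 / (z - r)) = -r * (1 / (z - r)) := by
      field_simp
      push_cast
      ring
    rw [e, norm_mul, norm_mul, norm_neg]
    gcongr
    linarith
  refine (Multiset.sum_le_card_nsmul _ _ hterm).trans ?_
  rw [Multiset.card_map, nsmul_eq_mul]
  have : (Q.roots.card : ℝ) ≤ Q.natDegree := by exact_mod_cast Q.card_roots'
  linarith

theorem Polynomial.norm_mul_derivative_le_of_lt_one {n : ℕ} (hn : 0 < n) {Q : ℂ[X]}
    (hdeg : Q.natDegree ≤ n) (hQ : ∀ z : ℂ, ‖z‖ < 1 → Q.eval z ≠ 0) {z : ℂ} (hz : ‖z‖ < 1) :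
    ‖z * (derivative Q).eval z‖ ≤ ‖n * Q.eval z - z * (derivative Q).eval z‖ := by
  have hQz := hQ z hz
  have h1 : (z * (derivative Q).eval z / Q.eval z).re ≤ (n : ℝ) / 2 :=
    (re_mul_derivative_div_le hQ hz).trans (by gcongr)
  have h2 := (Complex.norm_le_norm_ofReal_sub_iff (by exact_mod_cast hn) _).2 h1
  have e : n * Q.eval z - z * (derivative Q).eval z
      = (((n : ℝ) : ℂ) - z * (derivative Q).eval z / Q.eval z) * Q.eval z := by
    field_simp
    push_cast
    ring
  have h3 := mul_le_mul_of_nonneg_right h2 (norm_nonneg (Q.eval z))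
  rwa [← norm_mul, ← norm_mul, ← e, div_mul_cancel₀ _ hQz] at h3

/-- If nQ = zQ' at z, the previous inequality forces zQ' = 0, hence Q = 0 there. -/
theorem Polynomial.mul_eval_sub_mul_derivative_ne_zero {n : ℕ} (hn : 0 < n) {Q : ℂ[X]}
    (hdeg : Q.natDegree ≤ n) (hQ : ∀ z : ℂ, ‖z‖ < 1 → Q.eval z ≠ 0) {z : ℂ} (hz : ‖z‖ < 1) :
    n * Q.eval z - z * (derivative Q).eval z ≠ 0 := by
  intro h
  have h1 := norm_mul_derivative_le_of_lt_one hn hdeg hQ hz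
  rw [h, norm_zero, norm_le_zero_iff] at h1
  rw [h1, sub_zero] at h
  exact (mul_ne_zero (by exact_mod_cast hn.ne') (hQ z hz)) h

theorem tendsto_ofReal_mul_nhdsLT_one (z : ℂ) :
    Tendsto (fun r : ℝ => (r : ℂ) * z) (𝓝[<] 1) (𝓝 z) := by
  have : Continuous fun r : ℝ => (r : ℂ) * z := by fun_prop
  simpa using (this.tendsto 1).mono_left (nhdsWithin_le_nhds (s := Set.Iio 1))

theorem eventually_norm_ofReal_mul_lt_one {z : ℂ} (hz : ‖z‖ ≤ 1) :
    ∀ᶠ r : ℝ in 𝓝[<] 1, ‖(r : ℂ) * z‖ < 1 := by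
  filter_upwards [Ioo_mem_nhdsLT (zero_lt_one' ℝ)] with r hr
  rw [norm_mul, Complex.norm_real, Real.norm_of_nonneg hr.1.le]
  exact (mul_le_of_le_one_right hr.1.le hz).trans_lt hr.2

theorem Polynomial.norm_mul_derivative_le {n : ℕ} (hn : 0 < n) {Q : ℂ[X]}
    (hdeg : Q.natDegree ≤ n) (hQ : ∀ z : ℂ, ‖z‖ < 1 → Q.eval z ≠ 0) {z : ℂ} (hz : ‖z‖ ≤ 1) :
    ‖z * (derivative Q).eval z‖ ≤ ‖n * Q.eval z - z * (derivative Q).eval z‖ := by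
  have ht := tendsto_ofReal_mul_nhdsLT_one z
  have c1 : Continuous fun z => ‖z * (derivative Q).eval z‖ := by fun_prop
  have c2 : Continuous fun z => ‖n * Q.eval z - z * (derivative Q).eval z‖ := by fun_prop
  refine le_of_tendsto_of_tendsto ((c1.tendsto z).comp ht) ((c2.tendsto z).comp ht) ?_
  filter_upwards [eventually_norm_ofReal_mul_lt_one hz] with r hr
  exact norm_mul_derivative_le_of_lt_one hn hdeg hQ hr

/-- Schwarz lemma for the logarithmic derivative of a lacunary polynomial without zeros in the
unit disc. -/
theorem Polynomial.norm_mul_derivative_le_pow {n μ : ℕ} (hμ : 1 ≤ μ) (hn : 0 < n) {Q R : ℂ[X]}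
    {c : ℂ} (hform : Q = C c + X ^ μ * R) (hdeg : Q.natDegree ≤ n)
    (hQ : ∀ z : ℂ, ‖z‖ < 1 → Q.eval z ≠ 0) {z : ℂ} (hz : ‖z‖ ≤ 1) :
    ‖z * (derivative Q).eval z‖ ≤ ‖z‖ ^ μ * ‖n * Q.eval z - z * (derivative Q).eval z‖ := by
  -- S is zQ' divided by z^μ. On the unit circle the two have equal modulus, so the maximum
  -- principle for S against nQ - zQ' produces the factor |z|^μ.
  set S : ℂ[X] := C (μ : ℂ) * R + X * derivative R with hS
  have hfac : ∀ x : ℂ, x * (derivative Q).eval x = x ^ μ * S.eval x := by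
    intro x
    obtain ⟨ν, rfl⟩ := Nat.exists_eq_add_of_le' hμ
    rw [hform, hS]
    simp [derivative_mul]
    ring
  have heval : ∀ x : ℂ, (C (n : ℂ) * Q - X * derivative Q).eval x
      = n * Q.eval x - x * (derivative Q).eval x := by
    intro x
    simp
  have := norm_eval_le_of_circle (A := S) (B := C (n : ℂ) * Q - X * derivative Q)
    (fun x hx => by
      rw [heval]
      exact mul_eval_sub_mul_derivative_ne_zero hn hdeg hQ hx)
    (fun x hx => by
      have h := norm_mul_derivative_le hn hdeg hQ hx.le
      rwa [← heval, hfac, norm_mul, norm_pow, hx, one_pow, one_mul] at h) hz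
  rw [← heval, hfac, norm_mul, norm_pow]
  gcongr

/-- By the minimum principle |Q| ≥ M in the disc, so Q + lM has no zeros there for |l| < 1. It has
the same derivative as Q, and the lacunary estimate applied to it bounds |zQ'| for every l; the best
choice of l yields the extra term. -/
theorem Polynomial.norm_mul_derivative_add_le {n μ : ℕ} (hμ : 1 ≤ μ) (hn : 0 < n) {Q R : ℂ[X]}
    {c : ℂ} (hform : Q = C c + X ^ μ * R) (hdeg : Q.natDegree ≤ n)
    (hQ : ∀ z : ℂ, ‖z‖ < 1 → Q.eval z ≠ 0) {M : ℝ} (hM0 : 0 ≤ M)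
    (hM : ∀ z : ℂ, ‖z‖ = 1 → M ≤ ‖Q.eval z‖) {z : ℂ} (hz : ‖z‖ ≤ 1) :
    ‖z * (derivative Q).eval z‖ + n * M * ‖z‖ ^ μ
      ≤ ‖z‖ ^ μ * ‖n * Q.eval z - z * (derivative Q).eval z‖ := by
  have hMd : ∀ x : ℂ, ‖x‖ ≤ 1 → M ≤ ‖Q.eval x‖ := by
    intro x hx
    have := norm_eval_le_of_circle (A := C (M : ℂ)) (B := Q) hQ
      (fun y hy => by simpa [abs_of_nonneg hM0] using hM y hy) hx
    simpa [abs_of_nonneg hM0] using this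
  have hopen : ∀ l : ℂ, ‖l‖ < 1 → ‖z * (derivative Q).eval z‖
      ≤ ‖z‖ ^ μ * ‖n * (Q.eval z + l * M) - z * (derivative Q).eval z‖ := by
    intro l hl
    have hform' : Q + C (l * M) = C (c + l * M) + X ^ μ * R := by
      rw [C_add, hform]
      ring
    have h := norm_mul_derivative_le_pow hμ hn hform' (by rwa [natDegree_add_C])
      (fun x hx h0 => by
        rw [eval_add, eval_C, add_eq_zero_iff_eq_neg] at h0
        have h1 := hMd x hx.le
        rw [h0, norm_neg, norm_mul, Complex.norm_real, Real.norm_of_nonneg hM0] at h1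
        -- A zero of Q + lM gives M ≤ |l| M with |l| < 1, hence M = 0 and Q itself would vanish.
        have hMz : M = 0 := by nlinarith
        apply hQ x hx
        simp [h0, hMz]) hz
    simpa using h
  have hclosed : ∀ l : ℂ, ‖l‖ ≤ 1 → ‖z * (derivative Q).eval z‖
      ≤ ‖z‖ ^ μ * ‖n * (Q.eval z + l * M) - z * (derivative Q).eval z‖ := by
    intro l hl
    have hc : Continuous fun l : ℂ =>
        ‖z‖ ^ μ * ‖n * (Q.eval z + l * M) - z * (derivative Q).eval z‖ := by fun_prop
    refine ge_of_tendsto ((hc.tendsto l).comp (tendsto_ofReal_mul_nhdsLT_one l)) ?_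
    filter_upwards [eventually_norm_ofReal_mul_lt_one hl] with r hr
    exact hopen _ hr
  set N := n * Q.eval z - z * (derivative Q).eval z with hN
  have hl : ∀ l : ℂ, n * (Q.eval z + l * M) - z * (derivative Q).eval z = N + n * M * l := by
    intro l
    rw [hN]
    ring
  simp only [hl] at hclosed
  have hn' : (0 : ℝ) < n := by exact_mod_cast hn
  -- Otherwise l = -N/(nM) is admissible and annihilates the right side; then zQ' = 0, N = nQ, and
  -- |N| < nM contradicts |Q| ≥ M.
  have hNM : n * M ≤ ‖N‖ := by
    by_contra! hlt
    have hnM : 0 < n * M := (norm_nonneg _).trans_lt hlt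
    have hnMc : (n : ℂ) * M ≠ 0 := by exact_mod_cast hnM.ne'
    have h1 := hclosed (-N / (n * M)) (by
      rw [norm_div, norm_neg, norm_mul, Complex.norm_natCast, Complex.norm_real,
        Real.norm_of_nonneg hM0]
      exact div_le_one_of_le₀ hlt.le hnM.le)
    rw [mul_div_cancel₀ _ hnMc, add_neg_cancel, norm_zero, mul_zero, norm_le_zero_iff] at h1
    rw [hN, h1, sub_zero, norm_mul, Complex.norm_natCast] at hlt
    exact absurd (hMd z hz) (not_le.2 (lt_of_mul_lt_mul_left hlt hn'.le))
  rcases eq_or_ne N 0 with h0 | h0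
  · have hM' : n * M = 0 := le_antisymm (by simpa [h0] using hNM) (by positivity)
    have := hclosed 0 (by simp)
    simpa [hM'] using this
  · have hNpos := norm_pos_iff.2 h0
    have hNc : (‖N‖ : ℂ) ≠ 0 := by exact_mod_cast hNpos.ne'
    -- This unimodular l points against N, reducing |N + nMl| to |N| - nM.
    have h1 := hclosed (-N / ‖N‖) (by
      rw [norm_div, norm_neg, Complex.norm_real, norm_norm, div_self hNpos.ne'])
    have e : N + n * M * (-N / ‖N‖) = ((‖N‖ - n * M : ℝ) : ℂ) * (N / ‖N‖) := by
      push_cast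
      field_simp
      ring
    rw [e, norm_mul (Complex.ofReal _), Complex.norm_real, Real.norm_of_nonneg (sub_nonneg.2 hNM), norm_div,
      Complex.norm_real, norm_norm, div_self hNpos.ne', mul_one] at h1
    linarith

/-- The preceding estimate rescaled to polynomials without zeros in the disc of radius `1 / k`. -/
theorem Polynomial.norm_mul_derivative_add_le_of_radius {n μ : ℕ} (hμ : 1 ≤ μ) (hn : 0 < n)
    {Q R : ℂ[X]} {c : ℂ} (hform : Q = C c + X ^ μ * R) (hdeg : Q.natDegree ≤ n)
    {k : ℝ} (hk0 : 0 < k) (hk1 : k ≤ 1)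
    (hQ : ∀ z : ℂ, ‖z‖ < k⁻¹ → Q.eval z ≠ 0) {M : ℝ} (hM0 : 0 ≤ M)
    (hM : ∀ z : ℂ, ‖z‖ = k⁻¹ → M ≤ ‖Q.eval z‖) {z : ℂ} (hz : ‖z‖ = 1) :
    ‖z * (derivative Q).eval z‖ + n * M * k ^ μ
      ≤ k ^ μ * ‖n * Q.eval z - z * (derivative Q).eval z‖ := by
  have hkc : (k : ℂ) ≠ 0 := by exact_mod_cast hk0.ne'
  -- H(x) = Q(x/k) has no zeros in the unit disc; evaluating at kz, of modulus k, produces the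
  -- factor k^μ.
  set H : ℂ[X] := Q.comp (C (k⁻¹ : ℂ) * X) with hH
  have hHe : ∀ x, H.eval x = Q.eval ((k : ℂ)⁻¹ * x) := by
    intro x
    simp [hH]
  have hHd : (derivative H).eval (k * z) = (k : ℂ)⁻¹ * (derivative Q).eval z := by
    simp [hH, derivative_comp, hkc]
  have hnorm : ∀ x : ℂ, ‖(k : ℂ)⁻¹ * x‖ = k⁻¹ * ‖x‖ := by
    intro x
    rw [norm_mul, norm_inv, Complex.norm_real, Real.norm_of_nonneg hk0.le]
  have h := norm_mul_derivative_add_le (Q := H) (R := C ((k : ℂ)⁻¹ ^ μ) * R.comp (C (k⁻¹ : ℂ) * X))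
    (c := c) (z := k * z) hμ hn
    (by
      rw [hH, hform]
      simp only [add_comp, C_comp, mul_comp, pow_comp, X_comp, mul_pow, C_pow]
      ring)
    (natDegree_comp_le.trans (by
      refine (Nat.mul_le_mul_left _ (natDegree_C_mul_le _ _)).trans ?_
      rwa [natDegree_X, mul_one]))
    (fun x hx => by
      rw [hHe]
      refine hQ _ ?_
      rw [hnorm]
      exact mul_lt_of_lt_one_right (inv_pos.2 hk0) hx) hM0
    (fun x hx => by
      rw [hHe]
      refine hM _ ?_
      rw [hnorm, hx, mul_one])
    (by
      rw [norm_mul, hz, mul_one, Complex.norm_real, Real.norm_of_nonneg hk0.le]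
      exact hk1)
  have hkz : ‖(k : ℂ) * z‖ = k := by
    rw [norm_mul, hz, mul_one, Complex.norm_real, Real.norm_of_nonneg hk0.le]
  have e1 : (k : ℂ) * z * ((k : ℂ)⁻¹ * (derivative Q).eval z) = z * (derivative Q).eval z := by
    field_simp
  rwa [hHd, hHe, hkz, inv_mul_cancel_left₀ hkc, e1] at h

/-! ### The conjugate reciprocal polynomial -/

theorem Polynomial.eval_map_conj (P : ℂ[X]) (z : ℂ) :
    (P.map (starRingEnd ℂ)).eval z = starRingEnd ℂ (P.eval (starRingEnd ℂ z)) := by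
  rw [eval_map, ← eval₂_at_apply, Complex.conj_conj]

/-- The conjugate reciprocal `z ^ n * conj (P (1 / conj z))` of a polynomial of degree `n`. -/
noncomputable def Polynomial.conjReverse (P : ℂ[X]) : ℂ[X] := (P.map (starRingEnd ℂ)).reverse

namespace Polynomial

theorem eval_conjReverse (P : ℂ[X]) {z : ℂ} (hz : z ≠ 0) :
    P.conjReverse.eval z
      = z ^ P.natDegree * (P.map (starRingEnd ℂ)).eval z⁻¹ := by
  let : Invertible z⁻¹ := invertibleOfNonzero (inv_ne_zero hz)
  have h := eval₂_reverse_mul_pow (RingHom.id ℂ) z⁻¹ (P.map (starRingEnd ℂ))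
  have hi : ⅟(z⁻¹) = z := by rw [invOf_eq_inv, inv_inv]
  rw [hi, natDegree_map, ← eval, ← eval] at h
  rw [conjReverse, ← h, inv_pow]
  field_simp

/-- Away from 0, differentiate z^n f(1/z), where f is P with conjugated coefficients: in nQ - zQ'
the terms in f cancel and only f' survives. -/
theorem mul_eval_conjReverse_sub (P : ℂ[X]) {z : ℂ} (hz : z ≠ 0) :
    P.natDegree * P.conjReverse.eval z - z * (derivative P.conjReverse).eval z
      = z ^ P.natDegree * z⁻¹ * ((derivative P).map (starRingEnd ℂ)).eval z⁻¹ := by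
  set f := P.map (starRingEnd ℂ) with hf
  have h1 : HasDerivAt (fun x : ℂ => x ^ P.natDegree * f.eval x⁻¹)
      (P.natDegree * z ^ (P.natDegree - 1) * f.eval z⁻¹
        + z ^ P.natDegree * ((derivative f).eval z⁻¹ * (-(z ^ 2)⁻¹))) z :=
    (hasDerivAt_pow _ z).mul ((f.hasDerivAt z⁻¹).comp z (hasDerivAt_inv hz))
  have h2 : (fun x : ℂ => x ^ P.natDegree * f.eval x⁻¹) =ᶠ[𝓝 z] fun x => P.conjReverse.eval x := by
    filter_upwards [isOpen_ne.mem_nhds hz] with x hx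
    rw [eval_conjReverse P hx]
  rw [(P.conjReverse.hasDerivAt z).unique (h1.congr_of_eventuallyEq h2.symm),
    eval_conjReverse P hz, ← derivative_map, ← hf]
  -- Degree 0 is separate because of the truncated exponent n - 1.
  rcases P.natDegree with _ | n
  · simp
    field_simp
  · simp only [Nat.add_sub_cancel]
    push_cast
    field_simp
    ring

theorem coeff_conjReverse {P : ℂ[X]} {j : ℕ} (hj : j ≤ P.natDegree) :
    P.conjReverse.coeff j = starRingEnd ℂ (P.coeff (P.natDegree - j)) := by
  rw [conjReverse, coeff_reverse, natDegree_map, revAt_le hj, coeff_map]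

theorem natDegree_conjReverse_le (P : ℂ[X]) : P.conjReverse.natDegree ≤ P.natDegree := by
  rw [conjReverse]
  exact (reverse_natDegree_le _).trans natDegree_map_le

/-- Nonzero zeros of the reciprocal are the reflections 1/conj(ζ) of zeros ζ of P; its value at 0 is
the conjugate of the leading coefficient. -/
theorem conjReverse_eval_ne_zero {P : ℂ[X]} (hP : P ≠ 0) {k : ℝ} (hk0 : 0 < k)
    (hzeros : ∀ z : ℂ, P.eval z = 0 → ‖z‖ ≤ k) {z : ℂ} (hz : ‖z‖ < k⁻¹) :
    P.conjReverse.eval z ≠ 0 := by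
  rcases eq_or_ne z 0 with rfl | hz0
  · rw [← coeff_zero_eq_eval_zero, coeff_conjReverse (Nat.zero_le _)]
    simpa using hP
  · rw [eval_conjReverse P hz0, eval_map_conj]
    refine mul_ne_zero (pow_ne_zero _ hz0) fun h => ?_
    have h1 := hzeros _ ((map_eq_zero _).1 h)
    rw [Complex.norm_conj, norm_inv] at h1
    exact absurd hz (not_lt.2 (by
      rw [inv_le_comm₀ hk0 (norm_pos_iff.2 hz0)]
      exact h1))

theorem exists_conjReverse_eq {P : ℂ[X]} {n μ : ℕ} (hμn : μ ≤ n) (hdeg : P.natDegree = n)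
    (hcoeff : ∀ i, n - μ < i → i < n → P.coeff i = 0) :
    ∃ (c : ℂ) (R : ℂ[X]), P.conjReverse = C c + X ^ μ * R := by
  have hdvd : X ^ μ ∣ P.conjReverse - C (P.conjReverse.coeff 0) := by
    rw [X_pow_dvd_iff]
    intro d hd
    rcases Nat.eq_zero_or_pos d with rfl | hd0
    · simp
    · rw [coeff_sub, coeff_C_of_ne_zero hd0.ne', coeff_conjReverse (by omega), hdeg,
        hcoeff _ (by omega) (by omega)]
      simp
  obtain ⟨R, hR⟩ := hdvd
  exact ⟨_, R, by rw [← hR]; ring⟩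

theorem coeff_eq_zero_of_lacunary {P : ℂ[X]} {n μ : ℕ}
    (hform : P = C (P.coeff n) * X ^ n
      + ∑ j ∈ Finset.Icc μ n, C (P.coeff (n - j)) * X ^ (n - j)) {i : ℕ} (hi : n - μ < i)
    (hin : i < n) : P.coeff i = 0 := by
  rw [hform, coeff_add, finsetSum_coeff, coeff_C_mul_X_pow, if_neg hin.ne, zero_add]
  refine Finset.sum_eq_zero fun j hj => ?_
  rw [coeff_C_mul_X_pow, if_neg]
  have := Finset.mem_Icc.1 hj
  omega

theorem inv_eq_conj_of_norm_eq_one {z : ℂ} (hz : ‖z‖ = 1) : z⁻¹ = starRingEnd ℂ z := by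
  rw [Complex.inv_def, Complex.normSq_eq_norm_sq, hz]
  simp

theorem eval_conjReverse_of_norm_eq_one (P : ℂ[X]) {z : ℂ} (hz : ‖z‖ = 1) :
    P.conjReverse.eval z = z ^ P.natDegree * starRingEnd ℂ (P.eval z) := by
  rw [eval_conjReverse P (norm_ne_zero_iff.1 (by simp [hz])), eval_map_conj,
    inv_eq_conj_of_norm_eq_one hz, Complex.conj_conj]

theorem mul_eval_conjReverse_sub_of_norm_eq_one (P : ℂ[X]) {z : ℂ} (hz : ‖z‖ = 1) :
    P.natDegree * P.conjReverse.eval z - z * (derivative P.conjReverse).eval z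
      = z ^ P.natDegree * z⁻¹ * starRingEnd ℂ ((derivative P).eval z) := by
  rw [mul_eval_conjReverse_sub P (norm_ne_zero_iff.1 (by simp [hz])), eval_map_conj]
  congr 3
  rw [inv_eq_conj_of_norm_eq_one hz, Complex.conj_conj]

theorem norm_mul_eval_conjReverse_sub (P : ℂ[X]) {z : ℂ} (hz : ‖z‖ = 1) :
    ‖P.natDegree * P.conjReverse.eval z - z * (derivative P.conjReverse).eval z‖
      = ‖(derivative P).eval z‖ := by
  rw [mul_eval_conjReverse_sub_of_norm_eq_one P hz]
  simp [hz]

theorem norm_mul_derivative_conjReverse (P : ℂ[X]) {z : ℂ} (hz : ‖z‖ = 1) :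
    ‖z * (derivative P.conjReverse).eval z‖
      = ‖P.natDegree * P.eval z - z * (derivative P).eval z‖ := by
  have h := mul_eval_conjReverse_sub_of_norm_eq_one P hz
  rw [eval_conjReverse_of_norm_eq_one P hz, inv_eq_conj_of_norm_eq_one hz] at h
  have e : z * (derivative P.conjReverse).eval z = z ^ P.natDegree
      * starRingEnd ℂ (P.natDegree * P.eval z - z * (derivative P).eval z) := by
    rw [map_sub, map_mul, map_mul, Complex.conj_natCast]
    linear_combination -h
  rw [e, norm_mul, norm_pow, hz, one_pow, one_mul, Complex.norm_conj]

/-! ### Estimates on the unit circle for P and its polar derivative -/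

section Lacunary

variable {n μ : ℕ} {P : ℂ[X]} {k m : ℝ}

theorem norm_mul_derivative_conjReverse_add_le (hμ : 1 ≤ μ) (hμn : μ ≤ n)
    (hdeg : P.natDegree = n) (hcoeff : ∀ i, n - μ < i → i < n → P.coeff i = 0)
    (hk0 : 0 < k) (hk1 : k ≤ 1) (hzeros : ∀ z : ℂ, P.eval z = 0 → ‖z‖ ≤ k) (hm0 : 0 ≤ m)
    (hm : ∀ z : ℂ, ‖z‖ = k → m ≤ ‖P.eval z‖) {z : ℂ} (hz : ‖z‖ = 1) :
    ‖z * (derivative P.conjReverse).eval z‖ + n * m / k ^ (n - μ)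
      ≤ k ^ μ * ‖(derivative P).eval z‖ := by
  have hP : P ≠ 0 := by
    rintro rfl
    simp at hdeg
    omega
  obtain ⟨c, R, hform⟩ := exists_conjReverse_eq hμn hdeg hcoeff
  have h := norm_mul_derivative_add_le_of_radius hμ (by omega : 0 < n) hform
    -- M = m/k^n, because |Q(x)| = k^(-n) |P(1/conj x)| on |x| = 1/k and 1/conj x has modulus k.
    (hdeg ▸ natDegree_conjReverse_le P) hk0 hk1
    (fun x hx => conjReverse_eval_ne_zero hP hk0 hzeros hx) (M := m / k ^ n) (by positivity)
    (fun x hx => by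
      have hx0 : x ≠ 0 := norm_ne_zero_iff.1 (by rw [hx]; positivity)
      rw [eval_conjReverse P hx0, eval_map_conj, norm_mul, norm_pow, Complex.norm_conj, hx, hdeg,
        inv_pow, div_eq_inv_mul]
      gcongr
      exact hm _ (by rw [Complex.norm_conj, norm_inv, hx, inv_inv])) hz
  have h2 := norm_mul_eval_conjReverse_sub P hz
  rw [hdeg] at h2
  rw [h2] at h
  have e : (n : ℝ) * m / k ^ (n - μ) = n * (m / k ^ n) * k ^ μ := by
    have : k ^ n = k ^ (n - μ) * k ^ μ := by rw [← pow_add, Nat.sub_add_cancel hμn]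
    rw [this]
    field_simp
  rwa [e]

/-- Reverse triangle inequality for D_α P = αP' + (nP - zP'), with |nP - zP'| bounded by the
previous lemma. -/
theorem norm_polarDerivative_ge (hμ : 1 ≤ μ) (hμn : μ ≤ n)
    (hdeg : P.natDegree = n) (hcoeff : ∀ i, n - μ < i → i < n → P.coeff i = 0)
    (hk0 : 0 < k) (hk1 : k ≤ 1) (hzeros : ∀ z : ℂ, P.eval z = 0 → ‖z‖ ≤ k) (hm0 : 0 ≤ m)
    (hm : ∀ z : ℂ, ‖z‖ = k → m ≤ ‖P.eval z‖) (α : ℂ) {z : ℂ} (hz : ‖z‖ = 1) :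
    (‖α‖ - k ^ μ) * ‖(derivative P).eval z‖
      ≤ ‖(polarDerivative α P).eval z‖ - n * m / k ^ (n - μ) := by
  have h := norm_mul_derivative_conjReverse_add_le hμ hμn hdeg hcoeff hk0 hk1 hzeros hm0 hm hz
  rw [norm_mul_derivative_conjReverse P hz] at h
  have e : (polarDerivative α P).eval z
      = α * (derivative P).eval z - -(P.natDegree * P.eval z - z * (derivative P).eval z) := by
    simp [polarDerivative]
    ring
  have h1 := norm_sub_norm_le (α * (derivative P).eval z)
    (-(P.natDegree * P.eval z - z * (derivative P).eval z))
  rw [← e, norm_neg, norm_mul] at h1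
  linarith

/-- With w = A/B as below, (nQ - zQ')(1 + k^μ w) = n(Q + conj(δ) z^n), which on the circle equals n
z^n conj(P + δ). The term nm/k^(n-μ) in the derivative estimate is exactly what absorbs n|δ| and
keeps |w| ≤ 1. -/
theorem exists_subordinate_factor (hμ : 1 ≤ μ) (hμn : μ ≤ n)
    (hdeg : P.natDegree = n) (hcoeff : ∀ i, n - μ < i → i < n → P.coeff i = 0)
    (hk0 : 0 < k) (hk1 : k ≤ 1) (hzeros : ∀ z : ℂ, P.eval z = 0 → ‖z‖ ≤ k) (hm0 : 0 ≤ m)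
    (hm : ∀ z : ℂ, ‖z‖ = k → m ≤ ‖P.eval z‖) {β : ℂ} (hβ : ‖β‖ ≤ 1) :
    ∃ w : ℂ → ℂ, DiffContOnCl ℂ w (ball 0 1) ∧ w 0 = 0 ∧
      (∀ z ∈ closedBall (0 : ℂ) 1, ‖w z‖ ≤ 1) ∧
      ∀ z : ℂ, ‖z‖ = 1 → n * ‖P.eval z + (m : ℂ) * β / (k : ℂ) ^ (n - μ)‖
        = ‖(derivative P).eval z‖ * ‖1 + (k : ℂ) ^ μ * w z‖ := by
  have hP : P ≠ 0 := by
    rintro rfl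
    simp at hdeg
    omega
  have hn : 0 < n := by omega
  have hkc : (k : ℂ) ≠ 0 := by exact_mod_cast hk0.ne'
  set δ : ℂ := (m : ℂ) * β / (k : ℂ) ^ (n - μ) with hδ
  have hδn : n * ‖δ‖ ≤ n * m / k ^ (n - μ) := by
    rw [hδ, norm_div, norm_mul, norm_pow, Complex.norm_real, Complex.norm_real,
      Real.norm_of_nonneg hk0.le, Real.norm_of_nonneg hm0, ← mul_div_assoc]
    gcongr
    exact mul_le_of_le_one_right hm0 hβ
  set Q := P.conjReverse with hQ
  have hQ0 : ∀ x : ℂ, ‖x‖ < 1 → Q.eval x ≠ 0 := fun x hx =>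
    conjReverse_eval_ne_zero hP hk0 hzeros (hx.trans_le ((one_le_inv₀ hk0).2 hk1))
  set A : ℂ[X] := X * derivative Q + C (n * starRingEnd ℂ δ) * X ^ n with hA
  set B : ℂ[X] := C ((k : ℂ) ^ μ) * (C (n : ℂ) * Q - X * derivative Q) with hB
  have hAe : ∀ x, A.eval x = x * (derivative Q).eval x + n * starRingEnd ℂ δ * x ^ n := by
    intro x
    simp [hA]
  have hBe : ∀ x, B.eval x = (k : ℂ) ^ μ * (n * Q.eval x - x * (derivative Q).eval x) := by
    intro x
    simp [hB]
  have hB0 : ∀ x : ℂ, ‖x‖ < 1 → B.eval x ≠ 0 := by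
    intro x hx
    rw [hBe]
    exact mul_ne_zero (pow_ne_zero _ hkc)
      (mul_eval_sub_mul_derivative_ne_zero hn (hdeg ▸ natDegree_conjReverse_le P) hQ0 hx)
  have hN : ∀ x : ℂ, ‖x‖ = 1 → ‖n * Q.eval x - x * (derivative Q).eval x‖
      = ‖(derivative P).eval x‖ := by
    intro x hx
    have := norm_mul_eval_conjReverse_sub P hx
    rwa [hdeg] at this
  obtain ⟨w, hw, hw1, hwAB⟩ := exists_diffContOnCl_quotient hB0 (A := A) (fun x hx => by
    rw [hAe, hBe, norm_mul, hN x hx, norm_pow, Complex.norm_real, Real.norm_of_nonneg hk0.le]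
    refine (norm_add_le _ _).trans ?_
    refine le_trans ?_
      (norm_mul_derivative_conjReverse_add_le hμ hμn hdeg hcoeff hk0 hk1 hzeros hm0 hm hx)
    refine add_le_add_right ?_ _
    rw [norm_mul, norm_mul, norm_pow, hx, one_pow, mul_one, Complex.norm_conj,
      Complex.norm_natCast]
    exact hδn)
  refine ⟨w, hw, ?_, hw1, fun z hz => ?_⟩
  · have h := hwAB 0 (by simp)
    rw [hAe, zero_mul, zero_pow hn.ne', mul_zero, add_zero] at h
    exact (mul_eq_zero.1 h.symm).resolve_right (hB0 0 (by simp))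
  · have h := hwAB z (by simp [hz])
    rw [hAe, hBe] at h
    have hQz := eval_conjReverse_of_norm_eq_one P hz
    rw [hdeg, ← hQ] at hQz
    have e : (n * Q.eval z - z * (derivative Q).eval z) * (1 + (k : ℂ) ^ μ * w z)
        = z ^ n * (n * starRingEnd ℂ (P.eval z + δ)) := by
      rw [map_add]
      linear_combination -h + (n : ℂ) * hQz
    rw [← hN z hz, ← norm_mul, e, norm_mul, norm_mul, norm_pow, hz, one_pow, one_mul,
      Complex.norm_natCast, Complex.norm_conj]

end Lacunary

end Polynomial

/-! ### Hölder's inequality and the conclusion -/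

theorem memLp_of_continuous_Ioc {f : ℝ → ℝ} (hf : Continuous f) (a b : ℝ) (p : ENNReal) :
    MeasureTheory.MemLp f p (MeasureTheory.volume.restrict (Set.Ioc a b)) := by
  obtain ⟨K, hK⟩ := (isCompact_Icc (a := a) (b := b)).exists_bound_of_continuousOn hf.continuousOn
  refine MeasureTheory.MemLp.of_bound hf.aestronglyMeasurable K ?_
  filter_upwards [MeasureTheory.ae_restrict_mem measurableSet_Ioc] with x hx
  exact hK x (Set.Ioc_subset_Icc_self hx)

/-- Hölder's inequality for `p`-th powers, applied to a pointwise bound `K * G ≤ D * W`. -/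
theorem mul_integral_rpow_le_of_mul_le {G D W : ℝ → ℝ} (hG : Continuous G) (hD : Continuous D)
    (hW : Continuous W) (hG0 : ∀ x, 0 ≤ G x) (hD0 : ∀ x, 0 ≤ D x) (hW0 : ∀ x, 0 ≤ W x)
    {K : ℝ} (hK : 0 ≤ K) (h : ∀ x, K * G x ≤ D x * W x) {p r s : ℝ} (hp : 0 < p)
    (hrs : r.HolderConjugate s) {a b : ℝ} (hab : a ≤ b) :
    K * (∫ x in a..b, G x ^ p) ^ (1 / p)
      ≤ (∫ x in a..b, W x ^ (p * r)) ^ (1 / (p * r))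
        * (∫ x in a..b, D x ^ (p * s)) ^ (1 / (p * s)) := by
  have hGp : Continuous fun x => G x ^ p := hG.rpow_const fun _ => Or.inr hp.le
  have hDp : Continuous fun x => D x ^ p := hD.rpow_const fun _ => Or.inr hp.le
  have hWp : Continuous fun x => W x ^ p := hW.rpow_const fun _ => Or.inr hp.le
  have hI0 : 0 ≤ ∫ x in a..b, G x ^ p :=
    intervalIntegral.integral_nonneg hab fun x _ => Real.rpow_nonneg (hG0 x) p
  have hIW : 0 ≤ ∫ x in a..b, W x ^ (p * r) :=
    intervalIntegral.integral_nonneg hab fun x _ => Real.rpow_nonneg (hW0 x) _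
  have hID : 0 ≤ ∫ x in a..b, D x ^ (p * s) :=
    intervalIntegral.integral_nonneg hab fun x _ => Real.rpow_nonneg (hD0 x) _
  have hhol : ∫ x in a..b, W x ^ p * D x ^ p
      ≤ (∫ x in a..b, W x ^ (p * r)) ^ (1 / r) * (∫ x in a..b, D x ^ (p * s)) ^ (1 / s) := by
    have := MeasureTheory.integral_mul_le_Lp_mul_Lq_of_nonneg
      (μ := MeasureTheory.volume.restrict (Set.Ioc a b)) hrs
      (f := fun x => W x ^ p) (g := fun x => D x ^ p)
      (Eventually.of_forall fun x => Real.rpow_nonneg (hW0 x) p)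
      (Eventually.of_forall fun x => Real.rpow_nonneg (hD0 x) p)
      (memLp_of_continuous_Ioc hWp a b _) (memLp_of_continuous_Ioc hDp a b _)
    simp only [← Real.rpow_mul (hW0 _), ← Real.rpow_mul (hD0 _)] at this
    simpa only [intervalIntegral.integral_of_le hab] using this
  have hmono : K ^ p * ∫ x in a..b, G x ^ p ≤ ∫ x in a..b, W x ^ p * D x ^ p := by
    rw [← intervalIntegral.integral_const_mul]
    refine intervalIntegral.integral_mono_on hab ((hGp.const_mul _).intervalIntegrable _ _)
      ((hWp.mul hDp).intervalIntegrable _ _) fun x _ => ?_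
    rw [← Real.mul_rpow hK (hG0 x), ← Real.mul_rpow (hW0 x) (hD0 x), mul_comm (W x)]
    exact Real.rpow_le_rpow (mul_nonneg hK (hG0 x)) (h x) hp.le
  have hfin := Real.rpow_le_rpow (mul_nonneg (Real.rpow_nonneg hK p) hI0)
    (hmono.trans hhol) (one_div_nonneg.2 hp.le)
  rw [Real.mul_rpow (Real.rpow_nonneg hK p) hI0, ← Real.rpow_mul hK, mul_one_div_cancel hp.ne',
    Real.rpow_one, Real.mul_rpow (Real.rpow_nonneg hIW _) (Real.rpow_nonneg hID _),
    ← Real.rpow_mul hIW, ← Real.rpow_mul hID, one_div_mul_one_div, one_div_mul_one_div,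
    mul_comm r, mul_comm s] at hfin
  exact hfin

theorem theorem3 (n μ : ℕ) (hμ : 1 ≤ μ) (hμn : μ ≤ n)
    (P : ℂ[X]) (hdeg : P.natDegree = n)
    (hform : P = C (P.coeff n) * X ^ n
      + ∑ j ∈ Finset.Icc μ n, C (P.coeff (n - j)) * X ^ (n - j))
    (k : ℝ) (hk0 : 0 < k) (hk1 : k ≤ 1)
    (hzeros : ∀ z : ℂ, P.eval z = 0 → ‖z‖ ≤ k)
    (m : ℝ) (hm : IsLeast ((fun z : ℂ => ‖P.eval z‖) '' {z : ℂ | ‖z‖ = k}) m)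
    (α β : ℂ) (hα : k ^ μ ≤ ‖α‖) (hβ : ‖β‖ ≤ 1)
    (p r s : ℝ) (hp : 0 < p) (hr : 1 < r) (hs : 1 < s) (hrs : 1 / r + 1 / s = 1) :
    (∀ θ : ℝ, 0 ≤ ‖(polarDerivative α P).eval (Complex.exp (θ * Complex.I))‖
        - n * m / k ^ (n - μ)) ∧
    n * (‖α‖ - k ^ μ) *
        (∫ θ in (0 : ℝ)..(2 * Real.pi),
          ‖P.eval (Complex.exp (θ * Complex.I)) + (m : ℂ) * β / (k : ℂ) ^ (n - μ)‖ ^ p) ^ (1 / p)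
      ≤ (∫ θ in (0 : ℝ)..(2 * Real.pi),
          ‖1 + (k : ℂ) ^ μ * Complex.exp (θ * Complex.I)‖ ^ (p * r)) ^ (1 / (p * r))
        * (∫ θ in (0 : ℝ)..(2 * Real.pi),
          (‖(polarDerivative α P).eval (Complex.exp (θ * Complex.I))‖
            - n * m / k ^ (n - μ)) ^ (p * s)) ^ (1 / (p * s)) := by
  have hcoeff : ∀ i, n - μ < i → i < n → P.coeff i = 0 := fun i hi hin =>
    coeff_eq_zero_of_lacunary hform hi hin
  have hm0 : 0 ≤ m := by
    obtain ⟨z, -, rfl⟩ := hm.1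
    exact norm_nonneg _
  have hmin : ∀ z : ℂ, ‖z‖ = k → m ≤ ‖P.eval z‖ := fun z hz => hm.2 ⟨z, hz, rfl⟩
  have hpolar := fun z hz =>
    norm_polarDerivative_ge hμ hμn hdeg hcoeff hk0 hk1 hzeros hm0 hmin α (z := z) hz
  have hα' : 0 ≤ ‖α‖ - k ^ μ := sub_nonneg.2 hα
  have hpos : ∀ θ : ℝ, 0 ≤ ‖(polarDerivative α P).eval (Complex.exp (θ * Complex.I))‖
      - n * m / k ^ (n - μ) := fun θ =>
    (mul_nonneg hα' (norm_nonneg _)).trans (hpolar _ (Complex.norm_exp_ofReal_mul_I θ))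
  refine ⟨hpos, ?_⟩
  obtain ⟨w, hw, hw0, hw1, hfac⟩ :=
    exists_subordinate_factor hμ hμn hdeg hcoeff hk0 hk1 hzeros hm0 hmin hβ
  have hwc : Continuous fun θ : ℝ => w (Complex.exp (θ * Complex.I)) :=
    hw.continuousOn_closedBall_one.comp_continuous (by fun_prop) fun θ => by
      simp [Complex.norm_exp_ofReal_mul_I]
  have hsub := integral_norm_one_add_mul_rpow_le hw hw0 hw1 (pow_pos hk0 μ)
    (pow_le_one₀ hk0.le hk1) (q := p * r) (by positivity)
  push_cast at hsub
  have hconj : r.HolderConjugate s := Real.holderConjugate_iff.2 ⟨hr, by simpa using hrs⟩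
  have hmain := mul_integral_rpow_le_of_mul_le
    (G := fun θ : ℝ => ‖P.eval (Complex.exp (θ * Complex.I)) + (m : ℂ) * β / (k : ℂ) ^ (n - μ)‖)
    (D := fun θ : ℝ => ‖(polarDerivative α P).eval (Complex.exp (θ * Complex.I))‖
      - n * m / k ^ (n - μ))
    (W := fun θ : ℝ => ‖1 + (k : ℂ) ^ μ * w (Complex.exp (θ * Complex.I))‖)
    (K := n * (‖α‖ - k ^ μ)) (by fun_prop) (by fun_prop)
    ((hwc.const_mul _).const_add _).norm
    (fun _ => norm_nonneg _) hpos (fun _ => norm_nonneg _) (by positivity)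
    -- Multiply the polar derivative bound (|α| - k^μ)|P'| ≤ D by |1 + k^μ w| and replace |P'| |1 +
    -- k^μ w| by n|P + δ|.
    (fun θ => by
      have h1 := hfac _ (Complex.norm_exp_ofReal_mul_I θ)
      have h2 := mul_le_mul_of_nonneg_right (hpolar _ (Complex.norm_exp_ofReal_mul_I θ))
        (norm_nonneg (1 + (k : ℂ) ^ μ * w (Complex.exp (θ * Complex.I))))
      rw [mul_assoc, ← h1] at h2
      linarith) hp hconj Real.two_pi_pos.le
  refine hmain.trans ?_
  refine mul_le_mul_of_nonneg_right (Real.rpow_le_rpow ?_ hsub (by positivity))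
    (Real.rpow_nonneg ?_ _)
  · exact intervalIntegral.integral_nonneg Real.two_pi_pos.le
      fun θ _ => Real.rpow_nonneg (norm_nonneg _) _
  · exact intervalIntegral.integral_nonneg Real.two_pi_pos.le
      fun θ _ => Real.rpow_nonneg (hpos θ) _
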